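/- Let $R$ be a commutative ring with identity, let $S\subseteq R$ be a multiplicative subset (possibly containing zero-divisors), and let $R_S$ be the localization of $R$ at $S$. A short exact sequence $\eta:0\to N\to M\to L\to 0$ of $R$-modules is called $S$-pure exact if it is pure exact (i.e. $\eta\otimes_R X$ is exact for every $R$-module $X$), $\eta\otimes_R R_S$ is split exact as a sequence of $R_S$-modules, and $\eta\otimes_R R/sR$ is split exact as a sequence of $R/sR$-modules for every $s\in S$. An $R$-module $Y$ is $S$-pure injective if, for every $S$-pure exact sequence $0\to N\to M\to L\to 0$, every homomorphism $N\to Y$ extends to $M$. A homomorphism $f:F\to X$ is $S$-phantom if the pullback along $f$ of every short exact sequence $0\to K\to E\to X\to 0$ is $S$-pure exact. Let $S\text{-}\mathrm{Ph}$ be the class of $S$-phantom morphisms and $S\text{-}\mathrm{PInj}$ the class of $S$-pure injective modules. For homomorphisms $f:A\to B$ and $g:D\to E$ let $\mathrm{Ext}^1_R(f,g)$ be the induced map $\mathrm{Ext}^1_R(B,D)\to\mathrm{Ext}^1_R(A,E)$, and for a module $Y$ put $\mathrm{Ext}^1_R(f,Y)=\mathrm{Ext}^1_R(f,1_Y)$.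 For a class $\mathcal P$ of modules put ${}^\perp\mathcal P=\{f \mid \mathrm{Ext}^1_R(f,Y)=0\text{ for all }Y\in\mathcal P\}$, and let $\mathcal I(\mathcal P)$ be the class of morphisms that factor through a module in $\mathcal P$. For classes $\mathcal I,\mathcal J$ of morphisms put $\mathcal I^\perp=\{j\mid \mathrm{Ext}^1_R(i,j)=0\text{ for all }i\in\mathcal I\}$ and ${}^\perp\mathcal J=\{i\mid \mathrm{Ext}^1_R(i,j)=0\text{ for all }j\in\mathcal J\}$. An ideal of the category of $R$-modules is a class of morphisms that forms a subgroup of each $\mathrm{Hom}_R(A,B)$ and is closed under composition with arbitrary morphisms on either side. An ideal cotorsion pair is a pair $(\mathcal I,\mathcal J)$ of ideals with $\mathcal J=\mathcal I^\perp$ and $\mathcal I={}^\perp\mathcal J$. Proposition. A homomorphism $f:F\to X$ of $R$-modules is $S$-phantom if and only if $\mathrm{Ext}^1_R(f,Y)=0$ for every $S$-pure injective $R$-module $Y$. In other words, $S\text{-}\mathrm{Ph}={}^\perp(S\text{-}\mathrm{PInj})$; equivalently, $S\text{-}\mathrm{Ph}={}^\perp(\mathcal I(S\text{-}\mathrm{PInj}))$.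 In particular, $(S\text{-}\mathrm{Ph},(S\text{-}\mathrm{Ph})^\perp)$ is an ideal cotorsion pair. -/

import Mathlib

open CategoryTheory

universe u

namespace StrongPurity

section Purity

variable {R : Type u} [CommRing R]

/-- A short complex of `R`-modules is pure exact if it is short exact and stays short exact
after tensoring with any `R`-module. -/
structure IsPureExact (η : ShortComplex (ModuleCat.{u} R)) : Prop where
  shortExact : η.ShortExact
  tensor_shortExact : ∀ X : ModuleCat.{u} R,
    (η.map (MonoidalCategory.tensorRight X)).ShortExact

/-- Extension of scalars `M ↦ A ⊗[R] M` along the structure map of an `R`-algebra `A`,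
with values in `A`-modules. -/
noncomputable abbrev baseChange (A : Type u) [CommRing A] [Algebra R A] :
    ModuleCat.{u} R ⥤ ModuleCat.{u} A :=
  ModuleCat.extendScalars (algebraMap R A)

/-- `S`-pure exact sequences: pure exact sequences that become split exact over the
localization `S⁻¹R` and over every quotient ring `R/sR`, `s ∈ S`. -/
structure IsSPureExact (S : Submonoid R) (η : ShortComplex (ModuleCat.{u} R)) : Prop where
  pure : IsPureExact η
  localization_split : Nonempty (η.map (baseChange (Localization S))).Splitting
  quotient_split : ∀ s ∈ S, Nonempty (η.map (baseChange (R ⧸ Ideal.span {s}))).Splitting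

/-- `S`-pure injective modules: those that are injective with respect to all `S`-pure exact
sequences. -/
def IsSPureInjective (S : Submonoid R) : ObjectProperty (ModuleCat.{u} R) := fun M =>
  ∀ η : ShortComplex (ModuleCat.{u} R), IsSPureExact S η →
    ∀ h : η.X₁ ⟶ M, ∃ k : η.X₂ ⟶ M, η.f ≫ k = h

/-- `f : G ⟶ Z` is `S`-phantom if for every short exact sequence `0 → X → Y → Z → 0`, with
maps `i` and `p`, its pullback `0 → X → U → G → 0` along `f`, with maps `i'` and `p'`,
is `S`-pure exact. -/
def IsSPhantom (S : Submonoid R) : MorphismProperty (ModuleCat.{u} R) := fun G Z f =>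
  ∀ ⦃X Y U : ModuleCat.{u} R⦄ (i : X ⟶ Y) (p : Y ⟶ Z) (w : i ≫ p = 0)
    (i' : X ⟶ U) (p' : U ⟶ G) (w' : i' ≫ p' = 0) (q : U ⟶ Y),
    (ShortComplex.mk i p w).ShortExact → IsPullback q p' p f → i' ≫ q = i →
      IsSPureExact S (ShortComplex.mk i' p' w')

end Purity

section Ideals

variable {C : Type*} [Category C]

/-- A (two-sided) ideal of a preadditive category. -/
structure IsMorphismIdeal [Preadditive C] (I : MorphismProperty C) : Prop where
  zero_mem : ∀ A B : C, I (0 : A ⟶ B)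
  add_mem : ∀ {A B : C} {f g : A ⟶ B}, I f → I g → I (f + g)
  neg_mem : ∀ {A B : C} {f : A ⟶ B}, I f → I (-f)
  comp_mem : ∀ {A B D E : C} (h : D ⟶ A) {f : A ⟶ B} (g : B ⟶ E), I f → I (h ≫ f ≫ g)

/-- The morphisms that factor through an object of `P`. -/
def factorsThrough (P : ObjectProperty C) : MorphismProperty C := fun A B f =>
  ∃ (Y : C) (a : A ⟶ Y) (b : Y ⟶ B), P Y ∧ a ≫ b = f

end Ideals

section Orthogonality

variable {R : Type u} [CommRing R]

/-- `Ext¹(f, Y) = 0`, i.e. the map `Ext¹(B, Y) → Ext¹(A, Y)` induced by `f : A ⟶ B` is zero. -/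
def ExtObjZero {A B : ModuleCat.{u} R} (f : A ⟶ B) (Y : ModuleCat.{u} R) : Prop :=
  ∀ e : Abelian.Ext B Y 1, (Abelian.Ext.mk₀ f).comp e (zero_add 1) = 0

/-- `Ext¹(f, g) = 0`, i.e. the map `Ext¹(B, D) → Ext¹(A, E)` induced by `f : A ⟶ B` and
`g : D ⟶ E` is zero. -/
def ExtHomZero {A B D E : ModuleCat.{u} R} (f : A ⟶ B) (g : D ⟶ E) : Prop :=
  ∀ e : Abelian.Ext B D 1,
    (Abelian.Ext.mk₀ f).comp (e.comp (Abelian.Ext.mk₀ g) (add_zero 1)) (zero_add 1) = 0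

/-- `⊥P` for a class `P` of modules: the morphisms `f` with `Ext¹(f, Y) = 0` for all `Y` in
`P`. -/
def leftPerpObj (P : ObjectProperty (ModuleCat.{u} R)) : MorphismProperty (ModuleCat.{u} R) :=
  fun _ _ f => ∀ Y, P Y → ExtObjZero f Y

/-- `⊥J` for a class `J` of morphisms. -/
def leftPerp (J : MorphismProperty (ModuleCat.{u} R)) : MorphismProperty (ModuleCat.{u} R) :=
  fun _ _ f => ∀ ⦃D E : ModuleCat.{u} R⦄ (g : D ⟶ E), J g → ExtHomZero f g

/-- `I⊥` for a class `I` of morphisms. -/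
def rightPerp (I : MorphismProperty (ModuleCat.{u} R)) : MorphismProperty (ModuleCat.{u} R) :=
  fun _ _ g => ∀ ⦃A B : ModuleCat.{u} R⦄ (f : A ⟶ B), I f → ExtHomZero f g

/-- An ideal cotorsion pair: two ideals `I`, `J` with `J = I⊥` and `I = ⊥J`. -/
structure IsIdealCotorsionPair (I J : MorphismProperty (ModuleCat.{u} R)) : Prop where
  left_ideal : IsMorphismIdeal I
  right_ideal : IsMorphismIdeal J
  right_eq : J = rightPerp I
  left_eq : I = leftPerp J

end Orthogonality

end StrongPurity

namespace StrongPurity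

section Abelian

variable {C : Type*} [Category C] [Abelian C]

/-! Pulling an extension back along `f` acts on its class as `Ext¹(f, -)`, and a map `φ` out of the
kernel extends to the middle term exactly when `φ` pushes the class to zero. So `Ext¹(f, Y) = 0`
means that maps into `Y` extend along every pullback along `f` of a short exact sequence. It remains
to see that `S`-pure injectives detect `S`-purity (`isSPureExact_of_exists_extension`). Three
families suffice: character modules detect purity, while modules over `S⁻¹R` and over `R/sR`, viewed
over `R`, detect the two kinds of splitting. The cotorsion pair is then formal, as for any class of
the form `⊥J`. -/

/-- The pullback of a short exact sequence along a morphism is short exact. -/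
lemma shortExact_of_isPullback {X Y Z U G : C} {i : X ⟶ Y} {p : Y ⟶ Z} {w : i ≫ p = 0}
    {f : G ⟶ Z} {i' : X ⟶ U} {p' : U ⟶ G} (w' : i' ≫ p' = 0) {q : U ⟶ Y}
    (h : (ShortComplex.mk i p w).ShortExact) (hpb : IsPullback q p' p f) (hq : i' ≫ q = i) :
    (ShortComplex.mk i' p' w').ShortExact := by
  have : Mono i := h.mono_f
  have : Epi p := h.epi_g
  have hm : Mono i' := by
    have : Mono (i' ≫ q) := by rwa [hq]
    exact mono_of_mono i' q
  have he : Epi p' := Abelian.epi_snd_of_isLimit p f hpb.isLimit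
  refine .mk' (ShortComplex.exact_of_f_is_kernel _ ?_) hm he
  refine Limits.KernelFork.IsLimit.ofι' i' w' fun {A} k hk => ?_
  have hk' : (k ≫ q) ≫ p = 0 := by rw [Category.assoc, hpb.w, reassoc_of% hk, Limits.zero_comp]
  refine ⟨h.exact.lift (k ≫ q) hk', hpb.hom_ext ?_ ?_⟩
  · rw [Category.assoc, hq]
    exact h.exact.lift_f _ _
  · rw [Category.assoc, w', Limits.comp_zero, hk]

/-- Every short exact sequence has a pullback along every morphism into its last term. -/
lemma exists_isPullback_of_shortExact {X Y Z G : C} {i : X ⟶ Y} {p : Y ⟶ Z} (w : i ≫ p = 0)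
    (f : G ⟶ Z) :
    ∃ (U : C) (i' : X ⟶ U) (p' : U ⟶ G) (q : U ⟶ Y),
      i' ≫ p' = 0 ∧ IsPullback q p' p f ∧ i' ≫ q = i :=
  ⟨Limits.pullback p f, Limits.pullback.lift i 0 (by rw [w, Limits.zero_comp]),
    Limits.pullback.snd p f, Limits.pullback.fst p f, Limits.pullback.lift_snd _ _ _,
    .of_hasPullback p f, Limits.pullback.lift_fst _ _ _⟩

variable [HasExt C]

/-- The class of the pullback of an extension is the pullback of its class. -/
lemma extClass_of_isPullback {X Y Z U G : C} {i : X ⟶ Y} {p : Y ⟶ Z} {w : i ≫ p = 0}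
    {f : G ⟶ Z} {i' : X ⟶ U} {p' : U ⟶ G} {w' : i' ≫ p' = 0} {q : U ⟶ Y}
    (h : (ShortComplex.mk i p w).ShortExact) (h' : (ShortComplex.mk i' p' w').ShortExact)
    (hpb : IsPullback q p' p f) (hq : i' ≫ q = i) :
    h'.extClass = (Abelian.Ext.mk₀ f).comp h.extClass (zero_add 1) := by
  have := h'.extClass_naturality h
    { τ₁ := 𝟙 X, τ₂ := q, τ₃ := f, comm₁₂ := by simp [hq], comm₂₃ := hpb.w }
  simpa using this

/-- Every element of `Ext¹` is the class of an extension. -/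
lemma exists_extClass_eq [EnoughInjectives C] {X Y : C} (e : Abelian.Ext X Y 1) :
    ∃ (M : C) (i : Y ⟶ M) (p : M ⟶ X) (w : i ≫ p = 0)
      (h : (ShortComplex.mk i p w).ShortExact), h.extClass = e := by
  have hι : (ShortComplex.mk (Injective.ι Y) (Limits.cokernel.π (Injective.ι Y))
      (Limits.cokernel.condition _)).ShortExact :=
    .mk' (ShortComplex.exact_cokernel _) inferInstance inferInstance
  -- `e` dies in an injective hull of coefficients, so it comes from a map of `X` to the cokernel;
  -- pulling back along that map realizes `e`.
  obtain ⟨g, hg⟩ := Abelian.Ext.covariant_sequence_exact₁ X hι e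
    (Abelian.Ext.eq_zero_of_injective _) (zero_add 1)
  obtain ⟨g, rfl⟩ := Abelian.Ext.addEquiv₀.symm.surjective g
  obtain ⟨U, i', p', q, w', hpb, hq⟩ := exists_isPullback_of_shortExact
    (Limits.cokernel.condition (Injective.ι Y)) g
  have h' := shortExact_of_isPullback w' hι hpb hq
  exact ⟨U, i', p', w', h', (extClass_of_isPullback hι h' hpb hq).trans hg⟩

/-- A morphism extends along an extension if and only if it kills the class of the extension. -/
lemma extClass_comp_mk₀_eq_zero_iff {η : ShortComplex C} (h : η.ShortExact) {Y : C}
    (φ : η.X₁ ⟶ Y) :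
    h.extClass.comp (Abelian.Ext.mk₀ φ) (add_zero 1) = 0 ↔ ∃ k : η.X₂ ⟶ Y, η.f ≫ k = φ := by
  constructor
  · intro h0
    obtain ⟨k, hk⟩ := Abelian.Ext.contravariant_sequence_exact₁ h Y _ (add_zero 1) h0
    obtain ⟨k, rfl⟩ := Abelian.Ext.addEquiv₀.symm.surjective k
    refine ⟨k, Abelian.Ext.addEquiv₀.symm.injective ?_⟩
    simpa using hk
  · rintro ⟨k, rfl⟩
    rw [← Abelian.Ext.mk₀_comp_mk₀, h.extClass_comp_assoc]

end Abelian

/-! ### Test modules for `S`-purity -/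

section Purity

variable {R : Type u} [CommRing R]

/-- `A`-modules are injective, over `R`, with respect to the sequences of `R`-modules that split
after base change to `A`. -/
lemma exists_extension_of_splitting (A : Type u) [CommRing A] [Algebra R A]
    {η : ShortComplex (ModuleCat.{u} R)} (s : (η.map (baseChange A)).Splitting)
    (W : ModuleCat.{u} A) (h : η.X₁ ⟶ (ModuleCat.restrictScalars (algebraMap R A)).obj W) :
    ∃ k : η.X₂ ⟶ (ModuleCat.restrictScalars (algebraMap R A)).obj W, η.f ≫ k = h := by
  let adj := ModuleCat.extendRestrictScalarsAdj.{u} (algebraMap R A)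
  let r : (baseChange A).obj η.X₂ ⟶ (baseChange A).obj η.X₁ := s.r
  have hr : (baseChange A).map η.f ≫ r = 𝟙 _ := s.f_r
  refine ⟨adj.homEquiv _ _ (r ≫ (adj.homEquiv _ _).symm h), ?_⟩
  rw [← adj.homEquiv_naturality_left, reassoc_of% hr, Equiv.apply_symm_apply]

/-- A short exact sequence splits after base change to `A` if all morphisms from its first term
to `A`-modules extend. -/
lemma nonempty_splitting_of_exists_extension (A : Type u) [CommRing A] [Algebra R A]
    {η : ShortComplex (ModuleCat.{u} R)} (hη : η.ShortExact)
    (H : ∀ (W : ModuleCat.{u} A)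
      (h : η.X₁ ⟶ (ModuleCat.restrictScalars (algebraMap R A)).obj W),
      ∃ k : η.X₂ ⟶ (ModuleCat.restrictScalars (algebraMap R A)).obj W, η.f ≫ k = h) :
    Nonempty (η.map (baseChange A)).Splitting := by
  let adj := ModuleCat.extendRestrictScalarsAdj.{u} (algebraMap R A)
  have : (baseChange (R := R) A).IsLeftAdjoint := adj.isLeftAdjoint
  have := hη.epi_g
  -- The universal test is the unit of the adjunction: the transpose of an extension of it is a
  -- retraction.
  obtain ⟨k, hk⟩ := H ((baseChange A).obj η.X₁) (adj.unit.app η.X₁)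
  have hex : (η.map (baseChange A)).Exact :=
    hη.exact.map_of_epi_of_preservesCokernel _ inferInstance inferInstance
  refine ⟨.ofExactOfRetraction _ hex ((adj.homEquiv _ _).symm k) ?_
    (inferInstanceAs (Epi ((baseChange A).map η.g)))⟩
  refine (adj.homEquiv_naturality_left_symm η.f k).symm.trans ?_
  rw [hk, ← adj.homEquiv_id]
  exact Equiv.symm_apply_apply _ _

/-- A short exact sequence is pure exact if all morphisms from its first term to character
modules extend. -/
lemma isPureExact_of_exists_extension {η : ShortComplex (ModuleCat.{u} R)} (hη : η.ShortExact)
    (H : ∀ (Z : ModuleCat.{u} R) (h : η.X₁ ⟶ ModuleCat.of R (CharacterModule Z)),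
      ∃ k : η.X₂ ⟶ ModuleCat.of R (CharacterModule Z), η.f ≫ k = h) :
    IsPureExact η := by
  refine ⟨hη, fun Z => ?_⟩
  have := hη.epi_g
  have : (MonoidalCategory.tensorRight Z).PreservesEpimorphisms :=
    Functor.preservesEpimorphisms_of_adjunction (Adjunction.ofIsLeftAdjoint _)
  have he : Epi ((MonoidalCategory.tensorRight Z).map η.g) := inferInstance
  have : (η.map (MonoidalCategory.tensorRight Z)).HasHomology :=
    CategoryWithHomology.hasHomology _
  have hex : (η.map (MonoidalCategory.tensorRight Z)).Exact :=
    hη.exact.map_of_epi_of_preservesCokernel _ inferInstance inferInstance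
  refine .mk' hex ?_ he
  rw [ModuleCat.mono_iff_injective]
  -- Tensor-hom duality: the character module of `N ⊗ Z` is `Hom(N, Z⁺)`, where `Z⁺` is the
  -- character module of `Z`.
  refine (rTensor_injective_iff_lcomp_surjective (B := Z) (f := η.f.hom)).mpr fun h => ?_
  obtain ⟨k, hk⟩ := H Z (ModuleCat.ofHom h)
  exact ⟨k.hom, congrArg ModuleCat.Hom.hom hk⟩

lemma isSPureInjective_characterModule (S : Submonoid R) (Z : ModuleCat.{u} R) :
    IsSPureInjective S (ModuleCat.of R (CharacterModule Z)) := by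
  intro η hη h
  have hm := (ModuleCat.mono_iff_injective _).mp (hη.pure.tensor_shortExact Z).mono_f
  obtain ⟨k, hk⟩ := (rTensor_injective_iff_lcomp_surjective (B := Z) (f := η.f.hom)).mp hm h.hom
  exact ⟨ModuleCat.ofHom k, ModuleCat.hom_ext hk⟩

lemma isSPureInjective_restrictScalars_localization (S : Submonoid R)
    (W : ModuleCat.{u} (Localization S)) :
    IsSPureInjective S
      ((ModuleCat.restrictScalars (algebraMap R (Localization S))).obj W) :=
  fun _ hη => exists_extension_of_splitting _ hη.localization_split.some W

lemma isSPureInjective_restrictScalars_quotient (S : Submonoid R) {s : R} (hs : s ∈ S)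
    (W : ModuleCat.{u} (R ⧸ Ideal.span {s})) :
    IsSPureInjective S
      ((ModuleCat.restrictScalars (algebraMap R (R ⧸ Ideal.span {s}))).obj W) :=
  fun _ hη => exists_extension_of_splitting _ (hη.quotient_split s hs).some W

/-- A short exact sequence is `S`-pure exact as soon as all `S`-pure injective modules are
injective with respect to it. -/
lemma isSPureExact_of_exists_extension (S : Submonoid R) {η : ShortComplex (ModuleCat.{u} R)}
    (hη : η.ShortExact)
    (H : ∀ Y, IsSPureInjective S Y → ∀ h : η.X₁ ⟶ Y, ∃ k : η.X₂ ⟶ Y, η.f ≫ k = h) :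
    IsSPureExact S η where
  pure := isPureExact_of_exists_extension hη fun Z =>
    H _ (isSPureInjective_characterModule S Z)
  localization_split := nonempty_splitting_of_exists_extension _ hη fun W =>
    H _ (isSPureInjective_restrictScalars_localization S W)
  quotient_split _ hs := nonempty_splitting_of_exists_extension _ hη fun W =>
    H _ (isSPureInjective_restrictScalars_quotient S hs W)

theorem isSPhantom_iff_forall_extObjZero (S : Submonoid R) {F X : ModuleCat.{u} R} (f : F ⟶ X) :
    IsSPhantom S f ↔ ∀ Y : ModuleCat.{u} R, IsSPureInjective S Y → ExtObjZero f Y := by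
  constructor
  · intro hf Y hY e
    obtain ⟨M, i, p, w, h, rfl⟩ := exists_extClass_eq e
    obtain ⟨U, i', p', q, w', hpb, hq⟩ := exists_isPullback_of_shortExact w f
    have h' := shortExact_of_isPullback w' h hpb hq
    -- Extending the identity of the kernel `Y` splits the pullback, so its class vanishes.
    have h0 := (extClass_comp_mk₀_eq_zero_iff h' (𝟙 Y)).mpr
      (hY _ (hf i p w i' p' w' q h hpb hq) (𝟙 Y))
    rw [← extClass_of_isPullback h h' hpb hq]
    simpa using h0
  · intro hf K E U i p w i' p' w' q h hpb hq
    have h' := shortExact_of_isPullback w' h hpb hq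
    refine isSPureExact_of_exists_extension S h' fun Y hY φ => ?_
    -- Pullback along `f` commutes with pushout along `φ`, and the pushout has kernel `Y`, so `hf`
    -- applies to it.
    rw [← extClass_comp_mk₀_eq_zero_iff h' φ, extClass_of_isPullback h h' hpb hq,
      Abelian.Ext.comp_assoc _ _ _ (zero_add 1) (add_zero 1) (by lia)]
    exact hf Y hY _

end Purity

/-! ### Ideals and orthogonal classes -/

section Orthogonality

variable {R : Type u} [CommRing R]

lemma leftPerp_factorsThrough (P : ObjectProperty (ModuleCat.{u} R)) :
    leftPerp (factorsThrough P) = leftPerpObj P := by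
  ext A B f
  constructor
  · intro hf Y hY e
    simpa using hf (𝟙 Y) ⟨Y, 𝟙 Y, 𝟙 Y, hY, Category.comp_id _⟩ e
  · rintro hf D E _ ⟨Y, a, b, hY, rfl⟩ e
    have h := hf Y hY (e.comp (Abelian.Ext.mk₀ a) (add_zero 1))
    rw [← Abelian.Ext.mk₀_comp_mk₀,
      ← Abelian.Ext.comp_assoc _ _ _ (add_zero 1) (add_zero 0) (by lia),
      ← Abelian.Ext.comp_assoc _ _ _ (zero_add 1) (add_zero 1) (by lia), h,
      Abelian.Ext.zero_comp]

lemma isMorphismIdeal_leftPerp (J : MorphismProperty (ModuleCat.{u} R)) :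
    IsMorphismIdeal (leftPerp J) where
  zero_mem _ _ _ _ _ _ _ := by simp
  add_mem hf hg _ _ j hj e := by
    rw [Abelian.Ext.mk₀_add, Abelian.Ext.add_comp, hf j hj e, hg j hj e, add_zero]
  neg_mem hf _ _ j hj e := by
    rw [Abelian.Ext.mk₀_neg, Abelian.Ext.neg_comp, hf j hj e, neg_zero]
  comp_mem h f g hf _ _ j hj e := by
    have := hf j hj ((Abelian.Ext.mk₀ g).comp e (zero_add 1))
    rw [Abelian.Ext.comp_assoc _ _ _ (zero_add 1) (add_zero 1) (by lia)] at this
    rw [← Abelian.Ext.mk₀_comp_mk₀_assoc, ← Abelian.Ext.mk₀_comp_mk₀_assoc, this,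
      Abelian.Ext.comp_zero]

lemma isMorphismIdeal_rightPerp (I : MorphismProperty (ModuleCat.{u} R)) :
    IsMorphismIdeal (rightPerp I) where
  zero_mem _ _ _ _ _ _ _ := by simp
  add_mem hf hg _ _ i hi e := by
    rw [Abelian.Ext.mk₀_add, Abelian.Ext.comp_add, Abelian.Ext.comp_add, hf i hi e, hg i hi e,
      add_zero]
  neg_mem hf _ _ i hi e := by
    rw [Abelian.Ext.mk₀_neg, Abelian.Ext.comp_neg, Abelian.Ext.comp_neg, hf i hi e, neg_zero]
  comp_mem h f g hf _ _ i hi e := by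
    have := hf i hi (e.comp (Abelian.Ext.mk₀ h) (add_zero 1))
    rw [← Abelian.Ext.mk₀_comp_mk₀, ← Abelian.Ext.mk₀_comp_mk₀,
      ← Abelian.Ext.comp_assoc _ _ _ (add_zero 1) (add_zero 0) (by lia),
      ← Abelian.Ext.comp_assoc _ _ _ (add_zero 1) (add_zero 0) (by lia),
      ← Abelian.Ext.comp_assoc _ _ _ (zero_add 1) (add_zero 1) (by lia), this,
      Abelian.Ext.zero_comp]

/-- Every left orthogonal class is the left half of the ideal cotorsion pair it generates. -/
lemma isIdealCotorsionPair_leftPerp (J : MorphismProperty (ModuleCat.{u} R)) :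
    IsIdealCotorsionPair (leftPerp J) (rightPerp (leftPerp J)) where
  left_ideal := isMorphismIdeal_leftPerp J
  right_ideal := isMorphismIdeal_rightPerp _
  right_eq := rfl
  left_eq := by
    ext A B f
    -- The Galois connection identity `⊥((⊥J)⊥) = ⊥J`.
    exact ⟨fun hf _ _ _ hj => hj f hf, fun hf _ _ j hj => hf j fun _ _ _ hi => hi j hj⟩

end Orthogonality

end StrongPurity

theorem mainTheorem3 {R : Type u} [CommRing R] (S : Submonoid R) :
    (∀ {F X : ModuleCat.{u} R} (f : F ⟶ X),
      StrongPurity.IsSPhantom S f ↔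
        ∀ Y : ModuleCat.{u} R, StrongPurity.IsSPureInjective S Y →
          StrongPurity.ExtObjZero f Y) ∧
    StrongPurity.IsSPhantom S =
      StrongPurity.leftPerpObj (StrongPurity.IsSPureInjective S) ∧
    StrongPurity.IsSPhantom S =
      StrongPurity.leftPerp (StrongPurity.factorsThrough (StrongPurity.IsSPureInjective S)) ∧
    StrongPurity.IsIdealCotorsionPair (StrongPurity.IsSPhantom S)
      (StrongPurity.rightPerp (StrongPurity.IsSPhantom S)) := by
  have hobj : StrongPurity.IsSPhantom S =
      StrongPurity.leftPerpObj (StrongPurity.IsSPureInjective S) := by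
    ext F X f
    exact StrongPurity.isSPhantom_iff_forall_extObjZero S f
  have hmor := hobj.trans (StrongPurity.leftPerp_factorsThrough _).symm
  refine ⟨StrongPurity.isSPhantom_iff_forall_extObjZero S, hobj, hmor, ?_⟩
  rw [hmor]
  exact StrongPurity.isIdealCotorsionPair_leftPerp _
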